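/- **Lax pair of the spin elliptic Calogero–Moser system of a simple Lie algebra.** Let $\operatorname{Im}\tau>0$, $\Lambda=\mathbb Z+\mathbb Z\tau$, let $\wp(u)=\wp(u\mid 1,\tau)$ be the Weierstrass function with primitive periods $1,\tau$, and put $$\theta_1(u)=-\sum_{n\in\mathbb Z}\exp\Bigl(\pi i\tau(n+\tfrac12)^2+2\pi i(n+\tfrac12)(u+\tfrac12)\Bigr),\qquad \rho(u)=\frac{\theta_1'(u)}{\theta_1(u)},\qquad \sigma(u,z)=\frac{\theta_1(u-z)\,\theta_1'(0)}{\theta_1(z)\,\theta_1(u)} .$$ Let $\mathfrak g$ be a finite-dimensional complex simple Lie algebra, $\mathfrak h$ a Cartan subalgebra of dimension $\ell$, $\Delta$ the root system, and $B$ the Killing form. Let $h_1,\dots,h_\ell$ be a $B$-orthonormal basis of $\mathfrak h$, and for $\alpha\in\Delta$ let $e_\alpha\in\mathfrak g_\alpha$ be such that $[e_\alpha,e_{-\alpha}]=h_\alpha:=\sum_\mu\alpha(h_\mu)h_\mu$. The phase space is $\mathfrak h\times\mathfrak h\times\mathfrak g^*\ni(q,p,\xi)$ with the coordinates $q_\mu=B(q,h_\mu)$,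 $p_\mu=B(p,h_\mu)$, $F_\alpha=\xi(e_\alpha)$, $G_\mu=\xi(h_\mu)$. Its Poisson structure is the sum of the canonical one, $\{q_\mu,p_\nu\}=\delta_{\mu\nu}$, $\{q_\mu,q_\nu\}=\{p_\mu,p_\nu\}=0$, and the Kostant–Kirillov one on $\mathfrak g^*$, for which $\{\xi(X),\xi(Y)\}=\xi([X,Y])$ for $X,Y\in\mathfrak g$. Write $p\cdot p=B(p,p)$, $\alpha\cdot q=\alpha(q)$, and consider the Hamiltonian $$\mathcal H=\tfrac12\,p\cdot p-\tfrac12\sum_{\alpha\in\Delta}\wp(\alpha\cdot q)\,F_{-\alpha}F_\alpha .$$ Let $V$ be any finite-dimensional representation of $\mathfrak g$, let $E_\alpha$, $H_\mu$ be the endomorphisms of $V$ that represent $e_\alpha$, $h_\mu$, and put $$L(z)=\sum_{\mu=1}^{\ell}p_\mu H_\mu+\sum_{\alpha\in\Delta}\sigma(\alpha\cdot q,z)F_{-\alpha}E_\alpha,\qquad M(z)=-\sum_{\alpha\in\Delta}\sigma(\alpha\cdot q,z)\bigl(\rho(\alpha\cdot q)+\rho(z-\alpha\cdot q)\bigr)F_{-\alpha}E_\alpha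 .$$ Let $(q(t),p(t),\xi(t))$ be a solution of Hamilton's equations $\dfrac{df}{dt}=\{f,\mathcal H\}$, $f=q_\mu,p_\mu,F_\alpha,G_\mu$, for (real or complex) times $t$ in a set $I$, such that $\alpha\cdot q(t)\notin\Lambda$ for all $\alpha\in\Delta$ and $t\in I$, and such that the constraints $G_\mu=0$ $(\mu=1,\dots,\ell)$ hold along it. Then $$\frac{\partial L(z)}{\partial t}=[L(z),M(z)]$$ for all $t\in I$ and all $z\in\mathbb C$ with $z\notin\Lambda$ and $z-\alpha\cdot q(t)\notin\Lambda$ for all $\alpha\in\Delta$ (that is, wherever all the terms of $L(z)$ and $M(z)$ are defined). -/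

import Mathlib

noncomputable section

namespace SpinCalogeroMoser

open LieAlgebra LieModule

/-! ### Elliptic functions with primitive periods `1` and `τ` -/

/-- The pair of periods `(1, τ)`. -/
def periods (τ : UpperHalfPlane) : PeriodPair where
  ω₁ := 1
  ω₂ := (τ : ℂ)
  indep := by
    rw [LinearIndependent.pair_iff]
    intro s t h
    have him := congrArg Complex.im h
    have hre := congrArg Complex.re h
    simp at him hre
    have ht : t = 0 := him.resolve_right τ.im_pos.ne'
    subst ht
    simp at hre
    exact ⟨hre, rfl⟩

/-- The period lattice `ℤ + ℤ τ`. -/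
abbrev lattice (τ : UpperHalfPlane) : Submodule ℤ ℂ := (periods τ).lattice

/-- The Weierstrass function `℘(u) = ℘(u ∣ 1, τ)`. -/
abbrev wp (τ : UpperHalfPlane) (u : ℂ) : ℂ := (periods τ).weierstrassP u

/-- Jacobi's theta function
`θ₁(u) = - ∑ₙ exp (π i τ (n + 1/2)² + 2 π i (n + 1/2) (u + 1/2))`. -/
def theta₁ (τ : UpperHalfPlane) (u : ℂ) : ℂ :=
  -∑' n : ℤ, Complex.exp
    (Real.pi * Complex.I * (τ : ℂ) * ((n : ℂ) + 1 / 2) ^ 2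
      + 2 * Real.pi * Complex.I * ((n : ℂ) + 1 / 2) * (u + 1 / 2))

/-- The logarithmic derivative `ρ(u) = θ₁'(u) / θ₁(u)`. -/
def rho (τ : UpperHalfPlane) (u : ℂ) : ℂ :=
  deriv (theta₁ τ) u / theta₁ τ u

/-- `σ(u, z) = θ₁(u - z) θ₁'(0) / (θ₁(z) θ₁(u))`. -/
def sigma (τ : UpperHalfPlane) (u z : ℂ) : ℂ :=
  theta₁ τ (u - z) * deriv (theta₁ τ) 0 / (theta₁ τ z * theta₁ τ u)

section LieAlg

variable {𝔤 : Type*} [LieRing 𝔤] [LieAlgebra ℂ 𝔤] [FiniteDimensional ℂ 𝔤]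
  [LieAlgebra.IsSimple ℂ 𝔤] (𝔥 : LieSubalgebra ℂ 𝔤) [𝔥.IsCartanSubalgebra]

/-- A basis `{e_α, h_μ}` of `𝔤` adapted to the Cartan subalgebra `𝔥` (of dimension `ℓ`): the `h_μ`
are a basis of `𝔥`, orthonormal for the Killing form, and `e_α` lies in the root space of `α`,
with `[e_α, e_{-α}] = h_α = ∑_μ α(h_μ) h_μ` for every root `α`. The values of `e` at weights that
are not roots play no role. -/
structure AdaptedBasis (ℓ : ℕ) where
  /-- The orthonormal basis of the Cartan subalgebra. -/
  h : Module.Basis (Fin ℓ) ℂ 𝔥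
  /-- The root vectors. -/
  e : Weight ℂ 𝔥 𝔤 → 𝔤
  orthonormal : ∀ μ ν, killingForm ℂ 𝔤 (h μ : 𝔤) (h ν : 𝔤) = if μ = ν then 1 else 0
  e_mem : ∀ α ∈ 𝔥.root, e α ∈ rootSpace 𝔥 α
  lie_e_neg : ∀ α ∈ 𝔥.root, ⁅e α, e (-α)⁆ = ∑ μ, α (h μ) • (h μ : 𝔤)

/-- The phase space `𝔥 × 𝔥 × 𝔤*`, with points `(q, p, ξ)`. -/
abbrev PhaseSpace : Type _ := 𝔥 × 𝔥 × Module.Dual ℂ 𝔤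

variable {𝔥} {ℓ : ℕ} (b : AdaptedBasis 𝔥 ℓ)

/-- The coordinate `q_μ = q · h_μ`, the dot being the Killing form. -/
def qCoord (μ : Fin ℓ) (x : PhaseSpace 𝔥) : ℂ := killingForm ℂ 𝔤 (x.1 : 𝔤) (b.h μ : 𝔤)

/-- The momentum `p_μ = p · h_μ`. -/
def pCoord (μ : Fin ℓ) (x : PhaseSpace 𝔥) : ℂ := killingForm ℂ 𝔤 (x.2.1 : 𝔤) (b.h μ : 𝔤)

/-- The spin variable `F_α`, the coordinate of `𝔤*` given by `e_α`. -/
def F (α : Weight ℂ 𝔥 𝔤) (x : PhaseSpace 𝔥) : ℂ := x.2.2 (b.e α)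

/-- The spin variable `G_μ`, the coordinate of `𝔤*` given by `h_μ`. -/
def G (μ : Fin ℓ) (x : PhaseSpace 𝔥) : ℂ := x.2.2 (b.h μ : 𝔤)

/-- The Kostant-Kirillov Poisson bracket in the `𝔤*`-direction,
`{f, g}(q, p, ξ) = ∑_{i, j} ∂f/∂x_i ∂g/∂x_j ξ([x_i, x_j])`, where the `x_i` form a basis of `𝔤`,
that is, linear coordinates on `𝔤*`. (The choice of the basis does not matter.) -/
def kostantKirillov (f g : PhaseSpace 𝔥 → ℂ) (x : PhaseSpace 𝔥) : ℂ :=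
  let X := Module.finBasis ℂ 𝔤
  ∑ i, ∑ j, lineDeriv ℂ f x (0, 0, X.coord i) * lineDeriv ℂ g x (0, 0, X.coord j)
    * x.2.2 ⁅X i, X j⁆

/-- The Poisson bracket on `𝔥 × 𝔥 × 𝔤*`: the canonical one, `{q_μ, p_ν} = δ_{μν}`, on `𝔥 × 𝔥`
plus the Kostant-Kirillov one on `𝔤*`. As the `h_μ` are orthonormal, `∂/∂q_μ` and `∂/∂p_μ` are the
derivatives in the direction of `h_μ`. -/
def poissonBracket (f g : PhaseSpace 𝔥 → ℂ) (x : PhaseSpace 𝔥) : ℂ :=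
  ∑ μ, (lineDeriv ℂ f x (b.h μ, 0, 0) * lineDeriv ℂ g x (0, b.h μ, 0)
      - lineDeriv ℂ f x (0, b.h μ, 0) * lineDeriv ℂ g x (b.h μ, 0, 0))
    + kostantKirillov f g x

/-- The Hamiltonian `½ p · p - ½ ∑_α ℘(α · q) F_{-α} F_α`. -/
def hamiltonian (τ : UpperHalfPlane) (x : PhaseSpace 𝔥) : ℂ :=
  1 / 2 * killingForm ℂ 𝔤 (x.2.1 : 𝔤) (x.2.1 : 𝔤)
    - 1 / 2 * ∑ α ∈ 𝔥.root, wp τ (α x.1) * F b (-α) x * F b α x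

/-- `γ` is a solution, on the set `I` of (real or complex) times, of Hamilton's equations
`df/dt = {f, ℋ}`, `f = q_μ, p_μ, F_α, G_μ`, and avoids the poles of the Hamiltonian `ℋ`. -/
structure IsTrajectoryOn {𝕜 : Type*} [RCLike 𝕜] [NormedAlgebra 𝕜 ℂ] (τ : UpperHalfPlane)
    (γ : 𝕜 → PhaseSpace 𝔥) (I : Set 𝕜) : Prop where
  regular : ∀ t ∈ I, ∀ α ∈ 𝔥.root, α (γ t).1 ∉ lattice τ
  deriv_q : ∀ t ∈ I, ∀ μ, HasDerivAt (fun s => qCoord b μ (γ s))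
    (poissonBracket b (qCoord b μ) (hamiltonian b τ) (γ t)) t
  deriv_p : ∀ t ∈ I, ∀ μ, HasDerivAt (fun s => pCoord b μ (γ s))
    (poissonBracket b (pCoord b μ) (hamiltonian b τ) (γ t)) t
  deriv_F : ∀ t ∈ I, ∀ α ∈ 𝔥.root, HasDerivAt (fun s => F b α (γ s))
    (poissonBracket b (F b α) (hamiltonian b τ) (γ t)) t
  deriv_G : ∀ t ∈ I, ∀ μ, HasDerivAt (fun s => G b μ (γ s))
    (poissonBracket b (G b μ) (hamiltonian b τ) (γ t)) t

variable (V : Type*) [AddCommGroup V] [Module ℂ V] [LieRingModule 𝔤 V] [LieModule ℂ 𝔤 V]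

/-- `L(z) = P + ∑_α σ(α · q, z) F_{-α} E_α` with `P = ∑_μ p_μ H_μ`, where `E_α` and `H_μ` are the
endomorphisms of `V` that represent `e_α` and `h_μ`. -/
def laxL (τ : UpperHalfPlane) (z : ℂ) (x : PhaseSpace 𝔥) : Module.End ℂ V :=
  ∑ μ, pCoord b μ x • toEnd ℂ 𝔤 V (b.h μ : 𝔤)
    + ∑ α ∈ 𝔥.root, (sigma τ (α x.1) z * F b (-α) x) • toEnd ℂ 𝔤 V (b.e α)

/-- `M(z) = - ∑_α σ(α · q, z) (ρ(α · q) + ρ(z - α · q)) F_{-α} E_α`. -/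
def laxM (τ : UpperHalfPlane) (z : ℂ) (x : PhaseSpace 𝔥) : Module.End ℂ V :=
  -∑ α ∈ 𝔥.root,
    (sigma τ (α x.1) z * (rho τ (α x.1) + rho τ (z - α x.1)) * F b (-α) x)
      • toEnd ℂ 𝔤 V (b.e α)

end LieAlg

/-- `A' = dA/dt` at the time `t`, for a curve `A` of endomorphisms of a finite-dimensional
space `V`: all the matrix coefficients have the respective derivative. -/
def EndHasDerivAt {𝕜 : Type*} [RCLike 𝕜] [NormedAlgebra 𝕜 ℂ] {V : Type*} [AddCommGroup V]
    [Module ℂ V] (A : 𝕜 → Module.End ℂ V) (A' : Module.End ℂ V) (t : 𝕜) : Prop :=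
  ∀ (φ : Module.Dual ℂ V) (v : V), HasDerivAt (fun s => φ (A s v)) (φ (A' v)) t

end SpinCalogeroMoser

end

noncomputable section

namespace SpinCalogeroMoser

open Complex Set Filter Topology MeasureTheory

/-! ### Periodic entire functions and their Fourier coefficients -/

/-! The representation is linear, so the Lax equation reduces to an identity in `𝔤`. By
`hasDerivAt_sigma`, `∂σ/∂u = -σ(u,z)(ρ(u) + ρ(z-u))`, hence `M = ∑ ∂_uσ(α·q,z) F_{-α} E_α`. With `P
= ∑ p_μ H_μ`, the bracket `[P, M]` is the part of `dL/dt` caused by the motion of `q`. The bracket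
of the spin part of `L` with `M` has a Cartan component, which must be `dp/dt`, and root components,
which must be `σ dF/dt`. Two functional equations achieve this. `sigma_mul_sigma_neg_mul_rho` turns
the products for `α`, `-α` into `℘'`. `sigma_mul_sigma_mul_rho` turns those for `α`, `β` into
`σ(u+v,z)(℘(v) - ℘(u))`. The equation of motion of `F` also contains Cartan coordinates of `ξ`, and
the constraint `G = 0` removes them. The elliptic identities all come from one dimension count:
theta functions of order two form a space of dimension at most two. This forces
`θ₁(u+a)θ₁(u-a)θ₁'(0)² = θ₁(u)²θ₁(a)²(℘(a) - ℘(u))` off the lattice, which also locates the zeros of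
`θ₁` and yields the three-term identity; the latter's derivative is the functional equation for `α`,
`β`. -/

/-- For a primitive `g`, the shifted integral is `g (w + 1) - g w`, whose derivative in `w` vanishes
by periodicity. -/
theorem integral_add_const_of_periodic {f : ℂ → ℂ} (hf : Differentiable ℂ f)
    (hp : ∀ u, f (u + 1) = f u) (w : ℂ) :
    ∫ x in (0 : ℝ)..1, f (x + w) = ∫ x in (0 : ℝ)..1, f x := by
  obtain ⟨g, hg⟩ := hf.isExactOn_univ
  replace hg : ∀ u, HasDerivAt g (f u) u := fun u => hg u (mem_univ u)
  have key : ∀ w : ℂ, ∫ x in (0 : ℝ)..1, f (x + w) = g (w + 1) - g w := by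
    intro w
    rw [intervalIntegral.integral_eq_sub_of_hasDerivAt (f := fun x : ℝ => g (x + w))]
    · simp [add_comm]
    · intro x _
      exact ((hg _).comp_add_const (x : ℂ) w).comp_ofReal
    · exact (hf.continuous.comp (by fun_prop)).intervalIntegrable _ _
  have hd : ∀ u, HasDerivAt (fun u => g (u + 1) - g u) 0 u := fun u => by
    have h := ((hg (u + 1)).comp_add_const u 1).sub (hg u)
    rwa [hp, sub_self] at h
  have := is_const_of_deriv_eq_zero (fun u => (hd u).differentiableAt) (fun u => (hd u).deriv) w 0
  rw [key, this, ← key]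
  simp

/-- The Fourier coefficients of a function of period `1`. -/
def fourierInt (f : ℂ → ℂ) (n : ℤ) : ℂ :=
  ∫ x in (0 : ℝ)..1, f x * exp (-(2 * Real.pi * I * n * x))

/-- On the real line `f` descends to the circle and equals its Fourier series, which is zero; the
identity theorem extends this to `ℂ`. -/
theorem eq_zero_of_fourierInt_eq_zero {f : ℂ → ℂ} (hf : Differentiable ℂ f)
    (hp : ∀ u, f (u + 1) = f u) (h : ∀ n, fourierInt f n = 0) (u : ℂ) : f u = 0 := by
  have hper : Function.Periodic (fun x : ℝ => f x) 1 := fun x => by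
    simpa using hp x
  have hc : Continuous (fun x : ℝ => f x) := hf.continuous.comp continuous_ofReal
  let F : C(AddCircle (1 : ℝ), ℂ) := ⟨hper.lift, continuous_coinduced_dom.mpr hc⟩
  have hF : ∀ n, fourierCoeff F n = 0 := by
    intro n
    rw [fourierCoeff_eq_intervalIntegral _ n 0]
    simp only [fourier_coe_apply, zero_add, div_one, one_smul]
    rw [← h n, fourierInt]
    refine intervalIntegral.integral_congr fun x _ => ?_
    have : F (x : AddCircle (1 : ℝ)) = f x := rfl
    simp only [this, smul_eq_mul]
    rw [mul_comm]
    congr 2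
    push_cast
    ring
  have hreal : ∀ x : ℝ, f x = 0 := by
    intro x
    have hs : Summable (fourierCoeff F) := by simp [funext hF]
    have := has_pointwise_sum_fourier_series_of_summable hs (x : AddCircle (1 : ℝ))
    simp only [hF, zero_smul] at this
    exact this.unique hasSum_zero
  have han : AnalyticOnNhd ℂ f univ := hf.differentiableOn.analyticOnNhd isOpen_univ
  have hfreq : ∃ᶠ z in 𝓝[≠] (0 : ℂ), f z = 0 := by
    have ht : Tendsto (fun x : ℝ => (x : ℂ)) (𝓝[≠] 0) (𝓝[≠] 0) := by
      refine tendsto_nhdsWithin_iff.mpr ⟨?_, ?_⟩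
      · exact (continuous_ofReal.tendsto' 0 0 (by simp)).mono_left nhdsWithin_le_nhds
      · filter_upwards [self_mem_nhdsWithin] with x hx
        simpa using hx
    exact ht.frequently (Frequently.of_forall hreal)
  exact han.eqOn_zero_of_preconnected_of_frequently_eq_zero isPreconnected_univ (mem_univ 0)
    hfreq (mem_univ u)

/-! ### Theta functions of order two -/

/-- Entire functions with the periodicity of `θ₁ ^ 2`. -/
structure IsThetaOrderTwo (τ : UpperHalfPlane) (f : ℂ → ℂ) : Prop where
  differentiable : Differentiable ℂ f
  add_one : ∀ u, f (u + 1) = f u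
  add_tau : ∀ u, f (u + τ) = exp (-(2 * Real.pi * I * τ) - 4 * Real.pi * I * u) * f u

variable {τ : UpperHalfPlane}

theorem IsThetaOrderTwo.const_mul {f : ℂ → ℂ} (hf : IsThetaOrderTwo τ f) (c : ℂ) :
    IsThetaOrderTwo τ (fun u => c * f u) where
  differentiable := hf.differentiable.const_mul c
  add_one u := by rw [hf.add_one]
  add_tau u := by rw [hf.add_tau]; ring

theorem IsThetaOrderTwo.add {f g : ℂ → ℂ} (hf : IsThetaOrderTwo τ f) (hg : IsThetaOrderTwo τ g) :
    IsThetaOrderTwo τ (fun u => f u + g u) where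
  differentiable := hf.differentiable.add hg.differentiable
  add_one u := by rw [hf.add_one, hg.add_one]
  add_tau u := by rw [hf.add_tau, hg.add_tau]; ring

theorem fourierInt_const_mul (f : ℂ → ℂ) (c : ℂ) (n : ℤ) :
    fourierInt (fun u => c * f u) n = c * fourierInt f n := by
  simp only [fourierInt, mul_assoc, intervalIntegral.integral_const_mul]

theorem fourierInt_add {f g : ℂ → ℂ} (hf : Continuous f) (hg : Continuous g) (n : ℤ) :
    fourierInt (fun u => f u + g u) n = fourierInt f n + fourierInt g n := by
  simp only [fourierInt, add_mul]
  exact intervalIntegral.integral_add (Continuous.intervalIntegrable (by fun_prop) _ _)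
    (Continuous.intervalIntegrable (by fun_prop) _ _)

/-- Shifting the path of integration by `τ` and applying the quasi-periodicity raises the frequency
by two. -/
theorem IsThetaOrderTwo.fourierInt_eq {f : ℂ → ℂ} (hf : IsThetaOrderTwo τ f) (n : ℤ) :
    fourierInt f n = exp (-(2 * Real.pi * I * (n + 1) * τ)) * fourierInt f (n + 2) := by
  have hd := hf.differentiable
  have h := integral_add_const_of_periodic
    (f := fun u => f u * exp (-(2 * Real.pi * I * n * u))) (by fun_prop) (fun u => by
      rw [hf.add_one]
      congr 1
      rw [mul_add, neg_add, exp_add, mul_one, ← neg_mul, ← mul_neg_one,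
        show 2 * (Real.pi : ℂ) * I * n * (-1) = ((-n : ℤ) : ℂ) * (2 * Real.pi * I) by
          push_cast; ring, exp_int_mul_two_pi_mul_I]
      ring_nf) τ
  rw [fourierInt, ← h, fourierInt, ← intervalIntegral.integral_const_mul]
  refine intervalIntegral.integral_congr fun x _ => ?_
  simp only [hf.add_tau]
  rw [mul_comm (exp _) (f _), mul_assoc, ← exp_add, mul_left_comm, ← exp_add]
  congr 2
  push_cast
  ring

theorem IsThetaOrderTwo.eq_zero {f : ℂ → ℂ} (hf : IsThetaOrderTwo τ f)
    (h0 : fourierInt f 0 = 0) (h1 : fourierInt f 1 = 0) (u : ℂ) : f u = 0 := by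
  have hiff : ∀ n, fourierInt f n = 0 ↔ fourierInt f (n + 2) = 0 := fun n => by
    rw [hf.fourierInt_eq n, mul_eq_zero, or_iff_right (exp_ne_zero _)]
  have hpair : ∀ n : ℤ, fourierInt f n = 0 ∧ fourierInt f (n + 1) = 0 := by
    intro n
    induction n using Int.induction_on with
    | zero => exact ⟨h0, h1⟩
    | succ k ih => exact ⟨ih.2, by rw [add_assoc]; exact (hiff _).mp ih.1⟩
    | pred k ih =>
      refine ⟨(hiff _).mpr ?_, by simpa using ih.1⟩
      convert ih.2 using 2
      ring
  exact eq_zero_of_fourierInt_eq_zero hf.differentiable hf.add_one (fun n => (hpair n).1) u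

/-- Theta functions of order two form a space of dimension at most two. -/
theorem exists_linear_relation_of_isThetaOrderTwo {f g h : ℂ → ℂ} (hf : IsThetaOrderTwo τ f)
    (hg : IsThetaOrderTwo τ g) (hh : IsThetaOrderTwo τ h) :
    ∃ a b c : ℂ, (a ≠ 0 ∨ b ≠ 0 ∨ c ≠ 0) ∧ ∀ u, a * f u + b * g u + c * h u = 0 := by
  -- Coefficients `0` and `1` determine a theta function of order two, so a kernel vector of this `2
  -- × 3` matrix gives the relation.
  let A : (Fin 3 → ℂ) →ₗ[ℂ] (Fin 2 → ℂ) := Matrix.toLin'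
    !![fourierInt f 0, fourierInt g 0, fourierInt h 0;
      fourierInt f 1, fourierInt g 1, fourierInt h 1]
  obtain ⟨x, hx, hx0⟩ := Submodule.exists_mem_ne_zero_of_ne_bot
    (A.ker_ne_bot_of_finrank_lt (by simp))
  have hx' : A x = 0 := hx
  refine ⟨x 0, x 1, x 2, ?_, ?_⟩
  · contrapose! hx0
    ext i
    fin_cases i <;> simp [hx0]
  · have H := ((hf.const_mul (x 0)).add (hg.const_mul (x 1))).add (hh.const_mul (x 2))
    have hF : ∀ n, fourierInt (fun u => x 0 * f u + x 1 * g u + x 2 * h u) n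
        = x 0 * fourierInt f n + x 1 * fourierInt g n + x 2 * fourierInt h n := fun n => by
      have cf := hf.differentiable.continuous
      have cg := hg.differentiable.continuous
      have ch := hh.differentiable.continuous
      rw [fourierInt_add (f := fun u => x 0 * f u + x 1 * g u) (by fun_prop) (by fun_prop),
        fourierInt_add (by fun_prop) (by fun_prop)]
      simp only [fourierInt_const_mul]
    have e0 := congrFun hx' 0
    have e1 := congrFun hx' 1
    simp [A, Matrix.mulVec, dotProduct, Fin.sum_univ_three] at e0 e1
    refine H.eq_zero ?_ ?_
    · rw [hF]; linear_combination e0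
    · rw [hF]; linear_combination e1

/-! ### The theta function -/

theorem theta₁_eq_jacobiTheta₂ (u : ℂ) :
    theta₁ τ u = -exp (Real.pi * I * τ / 4 + Real.pi * I * (u + 1 / 2))
      * jacobiTheta₂ (u + 1 / 2 + τ / 2) τ := by
  rw [theta₁, jacobiTheta₂, neg_mul, ← tsum_mul_left]
  congr 1
  refine tsum_congr fun n => ?_
  rw [jacobiTheta₂_term, ← exp_add]
  ring_nf

theorem differentiable_theta₁ : Differentiable ℂ (theta₁ τ) := by
  intro u
  rw [funext theta₁_eq_jacobiTheta₂]
  have h : DifferentiableAt ℂ (fun u : ℂ => jacobiTheta₂ (u + 1 / 2 + τ / 2) τ) u :=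
    (differentiableAt_jacobiTheta₂_fst _ τ.im_pos).comp u
      (f := fun u : ℂ => u + 1 / 2 + τ / 2) (by fun_prop)
  fun_prop

theorem theta₁_add_one (u : ℂ) : theta₁ τ (u + 1) = -theta₁ τ u := by
  rw [theta₁_eq_jacobiTheta₂, theta₁_eq_jacobiTheta₂,
    show u + 1 + 1 / 2 + (τ : ℂ) / 2 = u + 1 / 2 + τ / 2 + 1 by ring, jacobiTheta₂_add_left,
    show Real.pi * I * (τ : ℂ) / 4 + Real.pi * I * (u + 1 + 1 / 2)
      = Real.pi * I * τ / 4 + Real.pi * I * (u + 1 / 2) + Real.pi * I by ring, exp_add, exp_pi_mul_I]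
  ring

theorem theta₁_add_tau (u : ℂ) :
    theta₁ τ (u + τ) = -exp (-(Real.pi * I * τ) - 2 * Real.pi * I * u) * theta₁ τ u := by
  rw [theta₁_eq_jacobiTheta₂, theta₁_eq_jacobiTheta₂,
    show u + τ + 1 / 2 + (τ : ℂ) / 2 = u + 1 / 2 + τ / 2 + τ by ring, jacobiTheta₂_add_left']
  have h : exp (Real.pi * I * τ / 4 + Real.pi * I * (u + τ + 1 / 2))
      * exp (-Real.pi * I * (τ + 2 * (u + 1 / 2 + τ / 2)))
      = -(exp (-(Real.pi * I * τ) - 2 * Real.pi * I * u)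
        * exp (Real.pi * I * τ / 4 + Real.pi * I * (u + 1 / 2))) := by
    rw [← neg_one_mul (_ * _), ← exp_pi_mul_I, ← exp_add, ← exp_add, ← exp_add,
      exp_eq_exp_iff_exists_int]
    -- The sign is written as `exp (π i)`; the exponents then differ by `-2 π i`.
    exact ⟨-1, by push_cast; ring⟩
  linear_combination -jacobiTheta₂ (u + 1 / 2 + τ / 2) τ * h

theorem theta₁_neg (u : ℂ) : theta₁ τ (-u) = -theta₁ τ u := by
  rw [theta₁_eq_jacobiTheta₂, theta₁_eq_jacobiTheta₂, ← jacobiTheta₂_neg_left,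
    show u + 1 / 2 + (τ : ℂ) / 2 = -(-u + 1 / 2 + τ / 2) + τ + 1 by ring, jacobiTheta₂_add_left,
    jacobiTheta₂_add_left', neg_mul, neg_mul, neg_neg, ← mul_assoc, ← exp_add, ← neg_mul,
    ← neg_one_mul (exp _), ← exp_pi_mul_I, ← exp_add]
  congr 1
  rw [exp_eq_exp_iff_exists_int]
  exact ⟨0, by push_cast; ring⟩

@[simp] theorem theta₁_zero : theta₁ τ 0 = 0 := by
  have := theta₁_neg (τ := τ) 0
  rw [neg_zero] at this
  linear_combination this / 2

/-- Only the term `n = 0` survives termwise integration. The value shows that theta is not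
identically zero. -/
theorem integral_jacobiTheta₂ : ∫ x in (0 : ℝ)..1, jacobiTheta₂ x τ = 1 := by
  have hs := intervalIntegral.hasSum_integral_of_dominated_convergence (μ := volume)
    (a := 0) (b := 1) (F := fun (n : ℤ) (x : ℝ) => jacobiTheta₂_term n x τ)
    (f := fun x : ℝ => jacobiTheta₂ x τ) (fun n _ => ‖jacobiTheta₂_term n 0 τ‖)
    (fun n => Continuous.aestronglyMeasurable (by unfold jacobiTheta₂_term; fun_prop))
    (fun n => .of_forall fun x _ => by simp [norm_jacobiTheta₂_term])
    (.of_forall fun x _ => ((summable_jacobiTheta₂_term_iff 0 τ).mpr τ.im_pos).norm)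
    intervalIntegrable_const
    (.of_forall fun x _ => hasSum_jacobiTheta₂_term x τ.im_pos)
  refine hs.unique ((hasSum_ite_eq (0 : ℤ) (1 : ℂ)).congr_fun fun n => ?_)
  split_ifs with hn
  · subst hn
    simp [jacobiTheta₂_term]
  · have hc : 2 * Real.pi * I * (n : ℂ) ≠ 0 := by
      simp [hn, Real.pi_ne_zero]
    simp only [jacobiTheta₂_term, exp_add, intervalIntegral.integral_mul_const]
    rw [integral_exp_mul_complex hc]
    have : exp (2 * Real.pi * I * (n : ℂ)) = 1 := by
      rw [mul_comm, exp_int_mul_two_pi_mul_I]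
    simp [this]

theorem exists_theta₁_ne_zero : ∃ u, theta₁ τ u ≠ 0 := by
  by_contra! h
  have h0 : ∀ z, jacobiTheta₂ z τ = 0 := fun z => by
    have := h (z - 1 / 2 - τ / 2)
    rw [theta₁_eq_jacobiTheta₂] at this
    rw [show z - 1 / 2 - (τ : ℂ) / 2 + 1 / 2 + τ / 2 = z by ring] at this
    simpa [exp_ne_zero] using this
  simpa [h0] using integral_jacobiTheta₂ (τ := τ)

theorem analyticAt_theta₁ (u : ℂ) : AnalyticAt ℂ (theta₁ τ) u :=
  differentiable_theta₁.analyticAt u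

theorem eventually_theta₁_ne_zero (u : ℂ) : ∀ᶠ v in 𝓝[≠] u, theta₁ τ v ≠ 0 := by
  have han : AnalyticOnNhd ℂ (theta₁ τ) univ := fun v _ => analyticAt_theta₁ v
  refine (analyticAt_theta₁ u).eventually_eq_zero_or_eventually_ne_zero.resolve_left fun h => ?_
  obtain ⟨v, hv⟩ := exists_theta₁_ne_zero (τ := τ)
  exact hv (han.eqOn_zero_of_preconnected_of_eventuallyEq_zero isPreconnected_univ (mem_univ u) h
    (mem_univ v))

/-- Theta functions of order two with zeros `± a`. -/
theorem isThetaOrderTwo_mul (a : ℂ) :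
    IsThetaOrderTwo τ (fun u => theta₁ τ (u + a) * theta₁ τ (u - a)) where
  differentiable := by
    have := differentiable_theta₁ (τ := τ)
    fun_prop
  add_one u := by
    rw [add_right_comm, add_sub_right_comm, theta₁_add_one, theta₁_add_one]
    ring
  add_tau u := by
    rw [add_right_comm, add_sub_right_comm, theta₁_add_tau, theta₁_add_tau]
    have h : exp (-(Real.pi * I * τ) - 2 * Real.pi * I * (u + a))
        * exp (-(Real.pi * I * τ) - 2 * Real.pi * I * (u - a))
        = exp (-(2 * Real.pi * I * τ) - 4 * Real.pi * I * u) := by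
      rw [← exp_add]
      ring_nf
    linear_combination theta₁ τ (u + a) * theta₁ τ (u - a) * h

end SpinCalogeroMoser

end

noncomputable section

namespace SpinCalogeroMoser

open Complex Set Filter Topology

variable {τ : UpperHalfPlane}

/-! ### The theta function and its derivative under lattice translations -/

theorem one_mem_lattice : (1 : ℂ) ∈ lattice τ := (periods τ).ω₁_mem_lattice

theorem tau_mem_lattice : (τ : ℂ) ∈ lattice τ := (periods τ).ω₂_mem_lattice

theorem theta₁_add_eq_zero_iff {l : ℂ} (hl : l ∈ lattice τ) (u : ℂ) :
    theta₁ τ (u + l) = 0 ↔ theta₁ τ u = 0 := by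
  revert u
  refine Submodule.span_induction (p := fun l _ => ∀ u, theta₁ τ (u + l) = 0 ↔ theta₁ τ u = 0)
    ?_ (by simp) (fun x y _ _ hx hy u => by rw [← add_assoc, hy, hx]) ?_ hl
  · rintro x (rfl | rfl) u
    · exact (theta₁_add_one u).symm ▸ neg_eq_zero
    · exact (theta₁_add_tau u).symm ▸ by simp [exp_ne_zero]
  · intro n x _ hx u
    induction n using Int.induction_on generalizing u with
    | zero => simp
    | succ k ih => rw [add_smul, one_smul, ← add_assoc, hx, ih]
    | pred k ih => rw [← hx, sub_smul, one_smul, add_assoc, sub_add_cancel, ih]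

theorem theta₁_eq_zero_of_mem {u : ℂ} (hu : u ∈ lattice τ) : theta₁ τ u = 0 := by
  simpa using (theta₁_add_eq_zero_iff hu 0).mpr theta₁_zero

theorem deriv_theta₁_add_one (u : ℂ) :
    deriv (theta₁ τ) (u + 1) = -deriv (theta₁ τ) u := by
  rw [← deriv_comp_add_const, funext theta₁_add_one, deriv.fun_neg]

theorem deriv_theta₁_neg (u : ℂ) : deriv (theta₁ τ) (-u) = deriv (theta₁ τ) u := by
  have h := deriv_comp_neg (theta₁ τ) u
  rw [funext theta₁_neg, deriv.fun_neg] at h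
  exact (neg_injective h).symm

/-- At a zero of `θ₁` the derivative of the exponential multiplier does not contribute. -/
theorem deriv_theta₁_add_tau {u : ℂ} (hu : theta₁ τ u = 0) :
    deriv (theta₁ τ) (u + τ)
      = -exp (-(Real.pi * I * τ) - 2 * Real.pi * I * u) * deriv (theta₁ τ) u := by
  rw [← deriv_comp_add_const, funext theta₁_add_tau,
    deriv_fun_mul (by fun_prop) differentiable_theta₁.differentiableAt, hu]
  simp

/-! ### The Weierstrass function near the origin -/

theorem isOpen_compl_lattice : IsOpen ((lattice τ : Set ℂ)ᶜ) :=
  (periods τ).isClosed_lattice.isOpen_compl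

theorem eventually_notMem_lattice (u : ℂ) : ∀ᶠ v in 𝓝[≠] u, v ∉ lattice τ := by
  filter_upwards [nhdsWithin_le_nhds ((periods τ).compl_lattice_sdiff_singleton_mem_nhds u),
    self_mem_nhdsWithin] with v hv hvu hl
  exact hv ⟨hl, hvu⟩

theorem differentiableAt_wp {u : ℂ} (hu : u ∉ lattice τ) : DifferentiableAt ℂ (wp τ) u :=
  (periods τ).differentiableOn_weierstrassP.differentiableAt (isOpen_compl_lattice.mem_nhds hu)

/-- The function equal to `1` at the pole `l` of `℘`, and to `(u - l)² ℘(u)` nearby. -/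
theorem differentiableAt_ite_sq_mul_wp {l : ℂ} (hl : l ∈ lattice τ) :
    DifferentiableAt ℂ (fun u => if u = l then 1 else (u - l) ^ 2 * wp τ u) l := by
  rw [funext ((periods τ).ite_eq_one_sub_sq_mul_weierstrassP l hl)]
  have := ((periods τ).analyticAt_weierstrassPExcept l).differentiableAt
  fun_prop

theorem tendsto_sq_mul_wp : Tendsto (fun u => u ^ 2 * wp τ u) (𝓝[≠] 0) (𝓝 1) := by
  have h := (differentiableAt_ite_sq_mul_wp (zero_mem (lattice τ))).continuousAt.tendsto
  rw [if_pos rfl] at h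
  refine (h.mono_left nhdsWithin_le_nhds).congr' ?_
  filter_upwards [self_mem_nhdsWithin] with u hu
  have hu' : u ≠ 0 := hu
  rw [if_neg hu', sub_zero]

/-- A constant would make `u² ℘(u)` tend to `0` instead of `1`. -/
theorem not_eventually_wp_eq (c : ℂ) : ¬∀ᶠ u in 𝓝[≠] 0, wp τ u = c := by
  intro h
  have h0 : Tendsto (fun u : ℂ => u ^ 2 * c) (𝓝[≠] 0) (𝓝 0) :=
    (Continuous.tendsto' (by fun_prop) 0 0 (by simp)).mono_left nhdsWithin_le_nhds
  refine zero_ne_one (tendsto_nhds_unique h0 (tendsto_sq_mul_wp (τ := τ) |>.congr' ?_))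
  filter_upwards [h] with u hu
  rw [hu]

/-! ### The product of theta functions in terms of the Weierstrass function -/

open Classical in
/-- The entire function `θ₁² ℘`. -/
def thetaSqWp (τ : UpperHalfPlane) (u : ℂ) : ℂ :=
  if u ∈ lattice τ then deriv (theta₁ τ) u ^ 2 else theta₁ τ u ^ 2 * wp τ u

theorem thetaSqWp_of_mem {u : ℂ} (hu : u ∈ lattice τ) :
    thetaSqWp τ u = deriv (theta₁ τ) u ^ 2 := if_pos hu

theorem thetaSqWp_of_notMem {u : ℂ} (hu : u ∉ lattice τ) :
    thetaSqWp τ u = theta₁ τ u ^ 2 * wp τ u := if_neg hu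

/-- Near a lattice point `l` the function is the square of the difference quotient of `θ₁` times the
regularised `(u - l)² ℘(u)`. -/
theorem differentiable_thetaSqWp : Differentiable ℂ (thetaSqWp τ) := by
  intro l
  by_cases hl : l ∈ lattice τ
  · have hd : DifferentiableAt ℂ (dslope (theta₁ τ) l) l :=
      ((differentiableOn_dslope univ_mem).mpr
        differentiable_theta₁.differentiableOn).differentiableAt univ_mem
    refine ((hd.pow 2).mul (differentiableAt_ite_sq_mul_wp hl)).congr_of_eventuallyEq ?_
    filter_upwards [(periods τ).compl_lattice_sdiff_singleton_mem_nhds l] with u hu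
    rcases eq_or_ne u l with rfl | hul
    · simp [thetaSqWp_of_mem hl]
    · have hu' : u ∉ lattice τ := fun h => hu ⟨h, hul⟩
      have h := sub_smul_dslope (theta₁ τ) l u
      rw [theta₁_eq_zero_of_mem hl, sub_zero, smul_eq_mul] at h
      simp only [thetaSqWp_of_notMem hu', Pi.mul_apply, Pi.pow_apply, if_neg hul, ← h]
      ring
  · have hd := (differentiable_theta₁ (τ := τ) l).pow 2 |>.mul (differentiableAt_wp hl)
    refine hd.congr_of_eventuallyEq ?_
    filter_upwards [isOpen_compl_lattice.mem_nhds hl] with u hu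
    exact thetaSqWp_of_notMem hu

theorem exp_tau_sq (u : ℂ) : (-exp (-(Real.pi * I * τ) - 2 * Real.pi * I * u)) ^ 2
    = exp (-(2 * Real.pi * I * τ) - 4 * Real.pi * I * u) := by
  rw [neg_sq, ← exp_nat_mul]
  push_cast
  ring_nf

theorem isThetaOrderTwo_thetaSqWp : IsThetaOrderTwo τ (thetaSqWp τ) where
  differentiable := differentiable_thetaSqWp
  add_one u := by
    have hm : u + 1 ∈ lattice τ ↔ u ∈ lattice τ := add_mem_cancel_right one_mem_lattice
    have hw : wp τ (u + 1) = wp τ u := (periods τ).weierstrassP_add_coe u ⟨1, one_mem_lattice⟩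
    by_cases hu : u ∈ lattice τ
    · rw [thetaSqWp_of_mem (hm.mpr hu), thetaSqWp_of_mem hu, deriv_theta₁_add_one, neg_sq]
    · rw [thetaSqWp_of_notMem (mt hm.mp hu), thetaSqWp_of_notMem hu, hw, theta₁_add_one, neg_sq]
  add_tau u := by
    have hm : u + τ ∈ lattice τ ↔ u ∈ lattice τ := add_mem_cancel_right tau_mem_lattice
    have hw : wp τ (u + τ) = wp τ u := (periods τ).weierstrassP_add_coe u ⟨τ, tau_mem_lattice⟩
    rw [← exp_tau_sq]
    by_cases hu : u ∈ lattice τ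
    · rw [thetaSqWp_of_mem (hm.mpr hu), thetaSqWp_of_mem hu,
        deriv_theta₁_add_tau (theta₁_eq_zero_of_mem hu)]
      ring
    · rw [thetaSqWp_of_notMem (mt hm.mp hu), thetaSqWp_of_notMem hu, hw, theta₁_add_tau]
      ring

theorem isThetaOrderTwo_sq : IsThetaOrderTwo τ (fun u => theta₁ τ u ^ 2) := by
  simpa [sq] using isThetaOrderTwo_mul (τ := τ) 0

/-- Both sides are combinations of three theta functions of order two, which are linearly dependent;
evaluation at `0` and `a` fixes the coefficients. The hypothesis `ha0` is separate from `ha` because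
the zeros of `θ₁` are only located afterwards, by means of this identity. -/
theorem theta₁_add_mul_theta₁_sub_of_ne_zero {a : ℂ} (ha : a ∉ lattice τ) (ha0 : theta₁ τ a ≠ 0)
    (u : ℂ) : theta₁ τ (u + a) * theta₁ τ (u - a) * deriv (theta₁ τ) 0 ^ 2
      = theta₁ τ u ^ 2 * thetaSqWp τ a - theta₁ τ a ^ 2 * thetaSqWp τ u := by
  obtain ⟨p, q, r, hne, h⟩ := exists_linear_relation_of_isThetaOrderTwo
    (isThetaOrderTwo_mul (τ := τ) a) isThetaOrderTwo_sq isThetaOrderTwo_thetaSqWp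
  -- Otherwise `q + r ℘` vanishes near `0`, although `℘` is not constant there.
  have hp : p ≠ 0 := by
    rintro rfl
    have hev : ∀ᶠ v in 𝓝[≠] (0 : ℂ), q + r * wp τ v = 0 := by
      filter_upwards [eventually_theta₁_ne_zero (τ := τ) 0, eventually_notMem_lattice (τ := τ) 0]
        with v hv hvl
      have := h v
      rw [thetaSqWp_of_notMem hvl] at this
      exact (mul_eq_zero.mp (by linear_combination this : theta₁ τ v ^ 2 * (q + r * wp τ v) = 0)
        ).resolve_left (pow_ne_zero 2 hv)
    rcases eq_or_ne r 0 with rfl | hr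
    · obtain ⟨v, hv⟩ := hev.exists
      simp_all
    · refine not_eventually_wp_eq (τ := τ) (-q / r) (hev.mono fun v hv => ?_)
      field_simp
      linear_combination hv
  have h0 := h 0
  have h1 := h a
  have hu := h u
  rw [thetaSqWp_of_mem (zero_mem _), zero_add, zero_sub, theta₁_neg, theta₁_zero] at h0
  rw [sub_self, theta₁_zero, thetaSqWp_of_notMem ha] at h1
  have hq : q + r * wp τ a = 0 := (mul_eq_zero.mp
    (by linear_combination h1 : theta₁ τ a ^ 2 * (q + r * wp τ a) = 0)).resolve_left
      (pow_ne_zero 2 ha0)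
  refine mul_left_cancel₀ hp ?_
  rw [thetaSqWp_of_notMem ha]
  linear_combination deriv (theta₁ τ) 0 ^ 2 * hu
    - deriv (theta₁ τ) 0 ^ 2 * theta₁ τ u ^ 2 * hq
    + (theta₁ τ u ^ 2 * wp τ a - thetaSqWp τ u) * h0

/-- If it vanished, the product formula would make `℘(v) = ℘(a)` for all `v ≠ 0` near `0`. -/
theorem deriv_theta₁_zero_ne_zero : deriv (theta₁ τ) 0 ≠ 0 := by
  intro h
  obtain ⟨a, ha0, ha⟩ :=
    ((eventually_theta₁_ne_zero (τ := τ) 0).and (eventually_notMem_lattice (τ := τ) 0)).exists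
  refine not_eventually_wp_eq (τ := τ) (wp τ a) ?_
  filter_upwards [eventually_theta₁_ne_zero (τ := τ) 0, eventually_notMem_lattice (τ := τ) 0]
    with v hv hvl
  have := theta₁_add_mul_theta₁_sub_of_ne_zero ha ha0 v
  rw [h, thetaSqWp_of_notMem ha, thetaSqWp_of_notMem hvl] at this
  have h2 : (theta₁ τ v * theta₁ τ a) ^ 2 * (wp τ v - wp τ a) = 0 := by
    linear_combination this
  exact sub_eq_zero.mp ((mul_eq_zero.mp h2).resolve_left (pow_ne_zero 2 (mul_ne_zero hv ha0)))

/-- At a zero `u` off the lattice, the product formula gives `θ₁(u+v) θ₁(u-v) = 0` for small `v ≠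
0`, contradicting the isolation of zeros. -/
theorem theta₁_ne_zero {u : ℂ} (hu : u ∉ lattice τ) : theta₁ τ u ≠ 0 := by
  intro h0
  have hadd : Tendsto (fun v : ℂ => u + v) (𝓝[≠] 0) (𝓝[≠] u) := by
    refine tendsto_nhdsWithin_iff.mpr
      ⟨(Continuous.tendsto' (by fun_prop) 0 u (by simp)).mono_left nhdsWithin_le_nhds, ?_⟩
    filter_upwards [self_mem_nhdsWithin] with v hv
    simpa using hv
  have hsub : Tendsto (fun v : ℂ => u - v) (𝓝[≠] 0) (𝓝[≠] u) := by
    refine tendsto_nhdsWithin_iff.mpr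
      ⟨(Continuous.tendsto' (by fun_prop) 0 u (by simp)).mono_left nhdsWithin_le_nhds, ?_⟩
    filter_upwards [self_mem_nhdsWithin] with v hv
    simpa using hv
  obtain ⟨v, ⟨⟨hv0, hvl⟩, h1⟩, h2⟩ := (((eventually_theta₁_ne_zero (τ := τ) 0).and
    (eventually_notMem_lattice (τ := τ) 0)).and
    (hadd.eventually (eventually_theta₁_ne_zero (τ := τ) u))).and
    (hsub.eventually (eventually_theta₁_ne_zero (τ := τ) u)) |>.exists
  have := theta₁_add_mul_theta₁_sub_of_ne_zero hvl hv0 u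
  rw [thetaSqWp_of_notMem hu, h0] at this
  simp [h1, h2, deriv_theta₁_zero_ne_zero] at this

theorem theta₁_add_mul_theta₁_sub (u a : ℂ) :
    theta₁ τ (u + a) * theta₁ τ (u - a) * deriv (theta₁ τ) 0 ^ 2
      = theta₁ τ u ^ 2 * thetaSqWp τ a - theta₁ τ a ^ 2 * thetaSqWp τ u := by
  by_cases ha : a ∈ lattice τ
  · by_cases hu : u ∈ lattice τ
    · rw [theta₁_eq_zero_of_mem ha, theta₁_eq_zero_of_mem hu,
        theta₁_eq_zero_of_mem (add_mem hu ha)]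
      ring
    · have := theta₁_add_mul_theta₁_sub_of_ne_zero hu (theta₁_ne_zero hu) a
      rw [← neg_sub u a, theta₁_neg, add_comm] at this
      linear_combination -this
  · exact theta₁_add_mul_theta₁_sub_of_ne_zero ha (theta₁_ne_zero ha) u

/-- **Weierstrass's three-term identity.** -/
theorem theta₁_three_term (a b c d : ℂ) :
    theta₁ τ (a + b) * theta₁ τ (a - b) * (theta₁ τ (c + d) * theta₁ τ (c - d))
      + theta₁ τ (a + c) * theta₁ τ (a - c) * (theta₁ τ (d + b) * theta₁ τ (d - b))
      + theta₁ τ (a + d) * theta₁ τ (a - d) * (theta₁ τ (b + c) * theta₁ τ (b - c)) = 0 := by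
  have hD : deriv (theta₁ τ) 0 ^ 4 ≠ 0 := pow_ne_zero 4 deriv_theta₁_zero_ne_zero
  refine (mul_eq_zero.mp (?_ : deriv (theta₁ τ) 0 ^ 4 * _ = 0)).resolve_left hD
  -- Each factor is a `2 × 2` minor of the vectors `(θ₁², θ₁² ℘)` at the four points, so the
  -- identity is the Plücker relation.
  have key : ∀ x y z w : ℂ, deriv (theta₁ τ) 0 ^ 4
      * (theta₁ τ (x + y) * theta₁ τ (x - y) * (theta₁ τ (z + w) * theta₁ τ (z - w)))
      = (theta₁ τ x ^ 2 * thetaSqWp τ y - theta₁ τ y ^ 2 * thetaSqWp τ x)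
        * (theta₁ τ z ^ 2 * thetaSqWp τ w - theta₁ τ w ^ 2 * thetaSqWp τ z) := fun x y z w => by
    rw [← theta₁_add_mul_theta₁_sub, ← theta₁_add_mul_theta₁_sub]
    ring
  rw [mul_add, mul_add, key, key, key]
  ring

theorem hasDerivAt_theta₁ (u : ℂ) : HasDerivAt (theta₁ τ) (deriv (theta₁ τ) u) u :=
  (differentiable_theta₁ u).hasDerivAt

/-- The infinitesimal form of the three-term identity. -/
theorem theta₁_three_term_deriv (u v z : ℂ) :
    theta₁ τ (u + v - z) * theta₁ τ (u - v) * theta₁ τ z * deriv (theta₁ τ) 0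
      = theta₁ τ u * theta₁ τ (u - z) * (theta₁ τ v * deriv (theta₁ τ) (v - z)
          - deriv (theta₁ τ) v * theta₁ τ (v - z))
        - theta₁ τ v * theta₁ τ (v - z) * (theta₁ τ u * deriv (theta₁ τ) (u - z)
          - deriv (theta₁ τ) u * theta₁ τ (u - z)) := by
  -- These are the variables of the three-term identity, which is differentiated in `d` at `d = c`;
  -- there `θ₁(c - d)` vanishes and only its derivative survives.
  obtain ⟨a, b, c, rfl, rfl, rfl⟩ : ∃ a b c, u = a + c ∧ v = b + c ∧ z = c + c :=
    ⟨u - z / 2, v - z / 2, z / 2, by ring, by ring, by ring⟩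
  have hadd : ∀ x : ℂ, HasDerivAt (fun d => theta₁ τ (x + d)) (deriv (theta₁ τ) (x + c)) c :=
    fun x => (hasDerivAt_theta₁ (x + c)).comp_const_add x c
  have hsub : ∀ x : ℂ, HasDerivAt (fun d => theta₁ τ (x - d)) (-deriv (theta₁ τ) (x - c)) c :=
    fun x => (hasDerivAt_theta₁ (x - c)).comp_const_sub x c
  have hsub' : HasDerivAt (fun d => theta₁ τ (d - b)) (deriv (theta₁ τ) (c - b)) c :=
    (hasDerivAt_theta₁ (c - b)).comp_sub_const c b
  have hadd' : HasDerivAt (fun d => theta₁ τ (d + b)) (deriv (theta₁ τ) (c + b)) c :=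
    (hasDerivAt_theta₁ (c + b)).comp_add_const c b
  have H := ((((hadd c).mul (hsub c)).const_mul (theta₁ τ (a + b) * theta₁ τ (a - b))).add
    ((hadd'.mul hsub').const_mul (theta₁ τ (a + c) * theta₁ τ (a - c)))).add
    (((hadd a).mul (hsub a)).mul_const (theta₁ τ (b + c) * theta₁ τ (b - c)))
  have H0 := H.unique ((hasDerivAt_const c (0 : ℂ)).congr_of_eventuallyEq
    (.of_forall fun d => theta₁_three_term a b c d))
  have e1 : c - b = -(b - c) := by ring
  rw [sub_self, theta₁_zero, e1, theta₁_neg, deriv_theta₁_neg, add_comm c b] at H0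
  rw [show a + c + (b + c) - (c + c) = a + b by ring, show a + c - (b + c) = a - b by ring,
    show b + c - (c + c) = b - c by ring, show a + c - (c + c) = a - c by ring]
  linear_combination -H0

/-! ### The functions `ρ` and `σ` -/

theorem sigma_mul_sigma_neg {u z : ℂ} (hu : u ∉ lattice τ) (hz : z ∉ lattice τ) :
    sigma τ u z * sigma τ (-u) z = wp τ z - wp τ u := by
  have h := theta₁_add_mul_theta₁_sub (τ := τ) u z
  rw [thetaSqWp_of_notMem hu, thetaSqWp_of_notMem hz] at h
  have h1 := theta₁_ne_zero hu
  have h2 := theta₁_ne_zero hz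
  simp only [sigma]
  rw [show -u - z = -(u + z) by ring, theta₁_neg, theta₁_neg]
  field_simp
  linear_combination h

theorem hasDerivAt_sigma {u z : ℂ} (hu : u ∉ lattice τ) (hz : z ∉ lattice τ)
    (huz : z - u ∉ lattice τ) :
    HasDerivAt (fun u => sigma τ u z) (-(sigma τ u z * (rho τ u + rho τ (z - u)))) u := by
  have h1 := theta₁_ne_zero hu
  have h2 := theta₁_ne_zero hz
  have h3 := theta₁_ne_zero huz
  have H := (((hasDerivAt_theta₁ (τ := τ) (u - z)).comp_sub_const u z).mul_const
    (deriv (theta₁ τ) 0)).div ((hasDerivAt_theta₁ (τ := τ) u).const_mul (theta₁ τ z))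
    (mul_ne_zero h2 h1)
  refine HasDerivAt.congr_deriv (f := fun u => sigma τ u z) H ?_
  simp only [sigma, rho]
  rw [← neg_sub z u, theta₁_neg, deriv_theta₁_neg]
  field_simp
  ring

theorem sigma_mul_sigma_mul_rho {u v z : ℂ} (hu : u ∉ lattice τ) (hv : v ∉ lattice τ)
    (huv : u + v ∉ lattice τ) (hz : z ∉ lattice τ) (huz : z - u ∉ lattice τ)
    (hvz : z - v ∉ lattice τ) :
    sigma τ u z * sigma τ v z * ((rho τ u + rho τ (z - u)) - (rho τ v + rho τ (z - v)))
      = sigma τ (u + v) z * (wp τ v - wp τ u) := by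
  have h := theta₁_add_mul_theta₁_sub (τ := τ) u v
  rw [thetaSqWp_of_notMem hu, thetaSqWp_of_notMem hv] at h
  have h' := theta₁_three_term_deriv (τ := τ) u v z
  have h1 := theta₁_ne_zero hu
  have h2 := theta₁_ne_zero hv
  have h3 := theta₁_ne_zero huv
  have h4 := theta₁_ne_zero hz
  have h5 := theta₁_ne_zero huz
  have h6 := theta₁_ne_zero hvz
  rw [← neg_sub z u, ← neg_sub z v, theta₁_neg, theta₁_neg, deriv_theta₁_neg,
    deriv_theta₁_neg] at h'
  simp only [sigma, rho]
  rw [← neg_sub z u, ← neg_sub z v, theta₁_neg, theta₁_neg]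
  field_simp
  linear_combination -(deriv (theta₁ τ) 0 ^ 2 * theta₁ τ (u + v)) * h'
    + deriv (theta₁ τ) 0 * theta₁ τ z * theta₁ τ (u + v - z) * h

/-- This is the `u`-derivative of `σ(u,z) σ(-u,z) = ℘(z) - ℘(u)`. -/
theorem sigma_mul_sigma_neg_mul_rho {u z : ℂ} (hu : u ∉ lattice τ) (hz : z ∉ lattice τ)
    (huz : z - u ∉ lattice τ) (huz' : z + u ∉ lattice τ) :
    sigma τ u z * sigma τ (-u) z * ((rho τ u + rho τ (z - u)) - (rho τ (-u) + rho τ (z + u)))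
      = deriv (wp τ) u := by
  have hd := hasDerivAt_sigma hu hz huz
  have hu' : -u ∉ lattice τ := by simpa using hu
  have hd' := (hasDerivAt_sigma hu' hz (by simpa using huz')).scomp u (hasDerivAt_neg u)
  have H := hd.mul hd'
  have H' : HasDerivAt (fun v => wp τ z - wp τ v) (-deriv (wp τ) u) u :=
    (differentiableAt_wp hu).hasDerivAt.const_sub _
  have := H.unique (H'.congr_of_eventuallyEq ?_)
  · simp only [sub_neg_eq_add, Function.comp_apply, smul_eq_mul] at this
    linear_combination -this
  · filter_upwards [isOpen_compl_lattice.mem_nhds hu] with v hv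
    exact sigma_mul_sigma_neg hv hz

end SpinCalogeroMoser

end

noncomputable section

namespace SpinCalogeroMoser

open LieAlgebra LieModule

section LieAlg

variable {𝔤 : Type*} [LieRing 𝔤] [LieAlgebra ℂ 𝔤] [FiniteDimensional ℂ 𝔤]
  [LieAlgebra.IsSimple ℂ 𝔤] {𝔥 : LieSubalgebra ℂ 𝔤} [𝔥.IsCartanSubalgebra]
  {ℓ : ℕ} (b : AdaptedBasis 𝔥 ℓ)

/-! ### Roots and the adapted basis -/

theorem neg_mem_root {α : Weight ℂ 𝔥 𝔤} (hα : α ∈ 𝔥.root) : -α ∈ 𝔥.root := by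
  simpa using hα

omit [LieAlgebra.IsSimple ℂ 𝔤] in
theorem not_isZero_of_mem_root {α : Weight ℂ 𝔥 𝔤} (hα : α ∈ 𝔥.root) : ¬α.IsZero := by
  simpa [Weight.IsNonZero] using hα

theorem sum_root_neg {M : Type*} [AddCommMonoid M] (f : Weight ℂ 𝔥 𝔤 → M) :
    ∑ α ∈ 𝔥.root, f (-α) = ∑ α ∈ 𝔥.root, f α :=
  Finset.sum_equiv (Equiv.neg _) (fun α => by simp) (fun α _ => rfl)

namespace AdaptedBasis

/-- The element `h_α = ∑_μ α(h_μ) h_μ`. -/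
def hRoot (α : Weight ℂ 𝔥 𝔤) : 𝔤 := ∑ μ, α (b.h μ) • (b.h μ : 𝔤)

theorem hRoot_neg (α : Weight ℂ 𝔥 𝔤) : b.hRoot (-α) = -b.hRoot α := by
  simp [hRoot]

theorem sum_killingForm_smul (x : 𝔥) :
    ∑ μ, killingForm ℂ 𝔤 (x : 𝔤) (b.h μ : 𝔤) • b.h μ = x := by
  conv_rhs => rw [← b.h.sum_repr x]
  refine Finset.sum_congr rfl fun μ _ => ?_
  congr 1
  conv_lhs => rw [← b.h.sum_repr x]
  simp [-Module.Basis.sum_repr, b.orthonormal]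

theorem sum_killingForm_mul_apply (α : Weight ℂ 𝔥 𝔤) (x : 𝔥) :
    ∑ μ, α (b.h μ) * killingForm ℂ 𝔤 (x : 𝔤) (b.h μ : 𝔤) = α x := by
  conv_rhs => rw [← b.sum_killingForm_smul x, ← Weight.toLinear_apply, map_sum]
  simp [mul_comm]

theorem killingForm_hRoot (α : Weight ℂ 𝔥 𝔤) (x : 𝔥) :
    killingForm ℂ 𝔤 (b.hRoot α) x = α x := by
  rw [← b.sum_killingForm_mul_apply α x, hRoot, map_sum, LinearMap.sum_apply]
  refine Finset.sum_congr rfl fun μ _ => ?_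
  rw [map_smul, LinearMap.smul_apply, smul_eq_mul, LieModule.traceForm_comm]

theorem hRoot_eq (α : Weight ℂ 𝔥 𝔤) :
    b.hRoot α = ((IsKilling.cartanEquivDual 𝔥).symm α.toLinear : 𝔥) := by
  have h : ∑ μ, α (b.h μ) • b.h μ = (IsKilling.cartanEquivDual 𝔥).symm α.toLinear := by
    rw [LinearEquiv.eq_symm_apply]
    ext x
    have hx : killingForm ℂ 𝔤 ((∑ μ, α (b.h μ) • b.h μ : 𝔥) : 𝔤) x = α x := by
      rw [← b.killingForm_hRoot α x]
      simp [hRoot]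
    exact hx
  rw [← h]
  simp [hRoot]

/-- In general `[e_α, e_{-α}] = B(e_α, e_{-α}) h_α` with `h_α` dual to `α`; the normalisation of the
basis and `h_α ≠ 0` force the factor to be `1`. -/
theorem killingForm_e_neg {α : Weight ℂ 𝔥 𝔤} (hα : α ∈ 𝔥.root) :
    killingForm ℂ 𝔤 (b.e α) (b.e (-α)) = 1 := by
  have h := IsKilling.lie_eq_killingForm_smul_of_mem_rootSpace_of_mem_rootSpace_neg
    (b.e_mem α hα) (b.e_mem (-α) (neg_mem_root hα))
  have h' : ⁅b.e α, b.e (-α)⁆ = b.hRoot α := b.lie_e_neg α hα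
  rw [h', ← b.hRoot_eq] at h
  have hne : b.hRoot α ≠ 0 := by
    intro h0
    refine not_isZero_of_mem_root hα ?_
    ext x
    simp [← b.killingForm_hRoot α x, h0]
  by_contra h1
  refine hne ((smul_eq_zero.mp (?_ : (killingForm ℂ 𝔤 (b.e α) (b.e (-α)) - 1) • b.hRoot α = 0)
    ).resolve_left (sub_ne_zero.mpr h1))
  rw [sub_smul, one_smul, ← h, sub_self]

theorem killingForm_e_eq_zero {χ : 𝔥 → ℂ} {α : Weight ℂ 𝔥 𝔤} (hα : α ∈ 𝔥.root) {x : 𝔤}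
    (hx : x ∈ rootSpace 𝔥 χ) (h : χ ≠ α) : killingForm ℂ 𝔤 x (b.e (-α)) = 0 := by
  refine killingForm_apply_eq_zero_of_mem_rootSpace_of_add_ne_zero ℂ 𝔤 𝔥 hx
    (b.e_mem (-α) (neg_mem_root hα)) ?_
  rwa [Weight.coe_neg, ← sub_eq_add_neg, sub_ne_zero]

omit [LieAlgebra.IsSimple ℂ 𝔤] in
theorem killingForm_h_eq_zero {χ : 𝔥 → ℂ} {x : 𝔤} (hx : x ∈ rootSpace 𝔥 χ) (h : χ ≠ 0)
    (y : 𝔥) : killingForm ℂ 𝔤 x y = 0 := by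
  refine killingForm_apply_eq_zero_of_mem_rootSpace_of_add_ne_zero ℂ 𝔤 𝔥 (β := 0) hx ?_ (by simpa)
  have := y.2
  rwa [← LieSubalgebra.mem_toLieSubmodule, ← rootSpace_zero_eq ℂ 𝔤 𝔥] at this

/-- The expansion of an element of `𝔤` in the adapted basis. -/
theorem expansion (x : 𝔤) :
    ∑ μ, killingForm ℂ 𝔤 x (b.h μ : 𝔤) • (b.h μ : 𝔤)
      + ∑ α ∈ 𝔥.root, killingForm ℂ 𝔤 x (b.e (-α)) • b.e α = x := by
  have hx : x ∈ ⨆ χ : Weight ℂ 𝔥 𝔤, (genWeightSpace 𝔤 χ).toSubmodule := by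
    rw [← LieSubmodule.iSup_toSubmodule, iSup_genWeightSpace_eq_top' ℂ 𝔥 𝔤]
    trivial
  induction hx using Submodule.iSup_induction' with
  | mem χ x hx =>
    by_cases hχ : χ.IsZero
    · have hx0 : x ∈ 𝔥 := by
        have hx' : x ∈ rootSpace 𝔥 (0 : 𝔥 → ℂ) := by
          have : (χ : 𝔥 → ℂ) = 0 := hχ
          rw [← this]
          exact hx
        rwa [rootSpace_zero_eq ℂ 𝔤 𝔥, LieSubalgebra.mem_toLieSubmodule] at hx'
      rw [Finset.sum_eq_zero (s := 𝔥.root), add_zero]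
      · have := congrArg ((↑) : 𝔥 → 𝔤) (b.sum_killingForm_smul ⟨x, hx0⟩)
        simpa using this
      · intro α hα
        rw [b.killingForm_e_eq_zero hα hx, zero_smul]
        intro h
        exact not_isZero_of_mem_root hα (h.symm.trans hχ)
    · have hχr : χ ∈ 𝔥.root := by simpa using hχ
      have he := b.killingForm_e_neg hχr
      have hne : (⟨b.e χ, b.e_mem χ hχr⟩ : rootSpace 𝔥 χ) ≠ 0 := by
        intro h
        have h0 : b.e χ = 0 := congrArg Subtype.val h
        simp [h0] at he
      -- Root spaces are lines, so `x` is a multiple of the root vector.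
      obtain ⟨c, hc⟩ := (finrank_eq_one_iff_of_nonzero' _ hne).mp
        (IsKilling.finrank_rootSpace_eq_one χ hχ) ⟨x, hx⟩
      have hc' : c • b.e χ = x := congrArg Subtype.val hc
      rw [Finset.sum_eq_zero (s := Finset.univ), zero_add, Finset.sum_eq_single_of_mem χ hχr]
      · rw [← hc', map_smul, LinearMap.smul_apply, he, smul_eq_mul, mul_one]
      · intro α hα hne
        rw [b.killingForm_e_eq_zero hα hx, zero_smul]
        intro h
        exact hne (DFunLike.coe_injective h.symm)
      · intro μ _
        rw [killingForm_h_eq_zero hx hχ, zero_smul]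
  | zero => simp
  | add x y _ _ hx hy =>
    conv_rhs => rw [← hx, ← hy]
    simp only [map_add, LinearMap.add_apply, add_smul, Finset.sum_add_distrib]
    abel

/-- The structure constants `c_{αβγ} = B([e_α, e_β], e_{-γ})`. -/
def structConst (α β γ : Weight ℂ 𝔥 𝔤) : ℂ := killingForm ℂ 𝔤 ⁅b.e α, b.e β⁆ (b.e (-γ))

theorem structConst_swap (α β γ : Weight ℂ 𝔥 𝔤) :
    b.structConst β α γ = -b.structConst α β γ := by
  rw [structConst, ← lie_skew, map_neg, LinearMap.neg_apply, structConst]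

theorem lie_e_mem {α β : Weight ℂ 𝔥 𝔤} (hα : α ∈ 𝔥.root) (hβ : β ∈ 𝔥.root) :
    ⁅b.e α, b.e β⁆ ∈ rootSpace 𝔥 (α + β : 𝔥 → ℂ) :=
  lie_mem_genWeightSpace_of_mem_genWeightSpace (b.e_mem α hα) (b.e_mem β hβ)

theorem coe_eq_add_of_structConst_ne_zero {α β γ : Weight ℂ 𝔥 𝔤} (hα : α ∈ 𝔥.root)
    (hβ : β ∈ 𝔥.root) (hγ : γ ∈ 𝔥.root) (h : b.structConst α β γ ≠ 0) (x : 𝔥) :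
    γ x = α x + β x := by
  by_contra hne
  refine h (b.killingForm_e_eq_zero hγ (b.lie_e_mem hα hβ) fun h' => hne ?_)
  rw [← h', Pi.add_apply]

-- The sum over all roots avoids deciding whether `α + β` is a root: its coefficients vanish unless
-- `γ = α + β`.
open Classical in
theorem lie_e {α β : Weight ℂ 𝔥 𝔤} (hα : α ∈ 𝔥.root) (hβ : β ∈ 𝔥.root) :
    ⁅b.e α, b.e β⁆ = (if β = -α then b.hRoot α else 0)
      + ∑ γ ∈ 𝔥.root, b.structConst α β γ • b.e γ := by
  split_ifs with h
  · subst h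
    rw [Finset.sum_eq_zero, add_zero]
    · exact b.lie_e_neg α hα
    · intro γ hγ
      by_contra hne
      refine not_isZero_of_mem_root hγ ?_
      ext x
      simp [b.coe_eq_add_of_structConst_ne_zero hα hβ hγ (left_ne_zero_of_smul hne) x]
  · rw [zero_add]
    conv_lhs => rw [← b.expansion ⁅b.e α, b.e β⁆]
    rw [Finset.sum_eq_zero, zero_add]
    · rfl
    · intro μ _
      rw [killingForm_h_eq_zero (b.lie_e_mem hα hβ), zero_smul]
      intro h0
      refine h (DFunLike.coe_injective ?_)
      rw [Weight.coe_neg]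
      exact (neg_eq_of_add_eq_zero_right h0).symm

theorem lie_h_e (x : 𝔥) {α : Weight ℂ 𝔥 𝔤} (hα : α ∈ 𝔥.root) :
    ⁅(x : 𝔤), b.e α⁆ = α x • b.e α :=
  IsKilling.lie_eq_smul_of_mem_rootSpace (b.e_mem α hα) x

/-- Invariance of the Killing form matches the constants in the equation of motion of `F` with those
in the Lax commutator. -/
theorem killingForm_lie_e_neg (α β γ : Weight ℂ 𝔥 𝔤) :
    killingForm ℂ 𝔤 ⁅b.e (-γ), b.e β⁆ (b.e α) = b.structConst β α γ := by
  rw [structConst, LieModule.traceForm_apply_lie_apply, LieModule.traceForm_comm]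

end AdaptedBasis

end LieAlg

end SpinCalogeroMoser

end

noncomputable section

namespace SpinCalogeroMoser

open LieAlgebra LieModule

section LieAlg

variable {𝔤 : Type*} [LieRing 𝔤] [LieAlgebra ℂ 𝔤] [FiniteDimensional ℂ 𝔤]
  [LieAlgebra.IsSimple ℂ 𝔤] {𝔥 : LieSubalgebra ℂ 𝔤} [𝔥.IsCartanSubalgebra]
  {ℓ : ℕ} (b : AdaptedBasis 𝔥 ℓ) {τ : UpperHalfPlane}

/-! ### Hamilton's equations -/

theorem lineDeriv_eq_of_forall_add {E : Type*} [AddCommGroup E] [Module ℂ E] {f : E → ℂ} {x v : E}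
    (h : ∀ s : ℂ, f (x + s • v) = f x + s * f v) : lineDeriv ℂ f x v = f v := by
  rw [lineDeriv, funext h]
  simp

theorem lineDeriv_qCoord (μ : Fin ℓ) (x v : PhaseSpace 𝔥) :
    lineDeriv ℂ (qCoord b μ) x v = qCoord b μ v :=
  lineDeriv_eq_of_forall_add fun s => by simp [qCoord]

theorem lineDeriv_pCoord (μ : Fin ℓ) (x v : PhaseSpace 𝔥) :
    lineDeriv ℂ (pCoord b μ) x v = pCoord b μ v :=
  lineDeriv_eq_of_forall_add fun s => by simp [pCoord]

theorem lineDeriv_F (α : Weight ℂ 𝔥 𝔤) (x v : PhaseSpace 𝔥) :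
    lineDeriv ℂ (F b α) x v = F b α v :=
  lineDeriv_eq_of_forall_add fun s => by simp [F]

theorem lineDeriv_hamiltonian {x : PhaseSpace 𝔥} (hx : ∀ α ∈ 𝔥.root, α x.1 ∉ lattice τ)
    (v : PhaseSpace 𝔥) :
    lineDeriv ℂ (hamiltonian b τ) x v = killingForm ℂ 𝔤 (x.2.1 : 𝔤) (v.2.1 : 𝔤)
      - 1 / 2 * ∑ α ∈ 𝔥.root, (deriv (wp τ) (α x.1) * α v.1 * (F b (-α) x * F b α x)
        + wp τ (α x.1) * (F b (-α) v * F b α x + F b (-α) x * F b α v)) := by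
  have hid := hasDerivAt_id (0 : ℂ)
  have hF : ∀ α, HasDerivAt (fun s : ℂ => F b α (x + s • v)) (F b α v) 0 := fun α => by
    simpa [F] using (hid.mul_const (F b α v)).const_add (F b α x)
  have hP : HasDerivAt (fun s : ℂ => killingForm ℂ 𝔤 ((x + s • v).2.1 : 𝔤) ((x + s • v).2.1 : 𝔤))
      (2 * killingForm ℂ 𝔤 (x.2.1 : 𝔤) (v.2.1 : 𝔤)) 0 := by
    have h1 := ((hid.mul_const (2 * killingForm ℂ 𝔤 (x.2.1 : 𝔤) (v.2.1 : 𝔤))).const_add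
      (killingForm ℂ 𝔤 (x.2.1 : 𝔤) (x.2.1 : 𝔤))).add
      ((hid.pow 2).mul_const (killingForm ℂ 𝔤 (v.2.1 : 𝔤) (v.2.1 : 𝔤)))
    refine (h1.congr_of_eventuallyEq (.of_forall fun s => ?_)).congr_deriv (by simp)
    have hc := LieModule.traceForm_comm ℂ 𝔤 𝔤 (v.2.1 : 𝔤) (x.2.1 : 𝔤)
    simp only [Prod.snd_add, Prod.fst_add, Prod.smul_snd, Prod.smul_fst, AddMemClass.coe_add, SetLike.val_smul, map_add, map_smul, LinearMap.add_apply, LinearMap.smul_apply,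
      smul_eq_mul, hc, id, Pi.add_apply, Pi.pow_apply]
    ring
  have hW : ∀ α ∈ 𝔥.root, HasDerivAt (fun s : ℂ => wp τ (α (x + s • v).1))
      (deriv (wp τ) (α x.1) * α v.1) 0 := fun α hα => by
    have hl : ∀ s : ℂ, α (x + s • v).1 = α x.1 + s * α v.1 := fun s => by
      rw [← Weight.toLinear_apply, ← Weight.toLinear_apply, ← Weight.toLinear_apply]
      simp
    have h1 : HasDerivAt (fun s : ℂ => α x.1 + s * α v.1) (α v.1) 0 := by
      simpa using (hid.mul_const (α v.1)).const_add (α x.1)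
    have h2 : HasDerivAt (wp τ) (deriv (wp τ) (α x.1)) (α x.1 + 0 * α v.1) := by
      simpa using (differentiableAt_wp (hx α hα)).hasDerivAt
    simp only [hl]
    exact h2.comp (0 : ℂ) h1
  refine (((hP.const_mul (1 / 2)).sub ((HasDerivAt.fun_sum fun α hα =>
    ((hW α hα).mul (hF (-α))).mul (hF α)).const_mul (1 / 2))).congr_deriv ?_).deriv
  congr 1
  · ring
  · congr 1
    refine Finset.sum_congr rfl fun α _ => ?_
    simp only [zero_smul, add_zero, Pi.mul_apply]
    ring

-- Collapses the Kostant–Kirillov double sum, once both differentials are identified with elements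
-- of `𝔤`.
omit [FiniteDimensional ℂ 𝔤] [LieAlgebra.IsSimple ℂ 𝔤] in
theorem sum_sum_coord_mul {ι : Type*} [Fintype ι] (X : Module.Basis ι ℂ 𝔤)
    (ξ : Module.Dual ℂ 𝔤) (y z : 𝔤) :
    ∑ i, ∑ j, X.coord i y * X.coord j z * ξ ⁅X i, X j⁆ = ξ ⁅y, z⁆ := by
  conv_rhs => rw [← X.sum_repr y, ← X.sum_repr z]
  simp only [sum_lie, lie_sum, smul_lie, lie_smul, map_sum, map_smul, smul_eq_mul,
    Module.Basis.coord_apply, Finset.mul_sum]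
  rw [Finset.sum_comm]
  exact Finset.sum_congr rfl fun j _ => Finset.sum_congr rfl fun i _ => by ring

omit [LieAlgebra.IsSimple ℂ 𝔤] in
theorem weight_apply_zero (α : Weight ℂ 𝔥 𝔤) : α (0 : 𝔥) = 0 := by
  rw [← Weight.toLinear_apply, map_zero]

/-- Since `℘` is even, `α ↦ -α` identifies the two halves of the product rule and cancels the factor
`1/2`. The differential along `𝔤*` becomes evaluation at one element of `𝔤`. -/
theorem lineDeriv_hamiltonian_dual {x : PhaseSpace 𝔥} (hx : ∀ α ∈ 𝔥.root, α x.1 ∉ lattice τ)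
    (ψ : Module.Dual ℂ 𝔤) : lineDeriv ℂ (hamiltonian b τ) x (0, 0, ψ)
      = -ψ (∑ β ∈ 𝔥.root, (wp τ (β x.1) * F b (-β) x) • b.e β) := by
  have hw : ∀ u, wp τ (-u) = wp τ u := (periods τ).weierstrassP_neg
  have h1 := sum_root_neg (𝔥 := 𝔥) fun β => wp τ (β x.1) * F b (-β) x * ψ (b.e β)
  simp only [Weight.coe_neg, Pi.neg_apply, hw, neg_neg] at h1
  have h2 : ∀ β : Weight ℂ 𝔥 𝔤, deriv (wp τ) (β x.1) * β (0 : 𝔥) * (F b (-β) x * F b β x)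
      + wp τ (β x.1) * (ψ (b.e (-β)) * F b β x + F b (-β) x * ψ (b.e β))
      = wp τ (β x.1) * F b β x * ψ (b.e (-β)) + wp τ (β x.1) * F b (-β) x * ψ (b.e β) :=
    fun β => by rw [weight_apply_zero]; ring
  rw [lineDeriv_hamiltonian b hx]
  have h3 : ∀ β, F b β ((0, 0, ψ) : PhaseSpace 𝔥) = ψ (b.e β) := fun _ => rfl
  simp only [h3, h2]
  simp only [Finset.sum_add_distrib, h1, map_sum, map_smul, smul_eq_mul,
    ZeroMemClass.coe_zero, map_zero]
  ring

theorem poissonBracket_qCoord {x : PhaseSpace 𝔥} (hx : ∀ α ∈ 𝔥.root, α x.1 ∉ lattice τ)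
    (μ : Fin ℓ) : poissonBracket b (qCoord b μ) (hamiltonian b τ) x = pCoord b μ x := by
  simp only [poissonBracket, kostantKirillov, lineDeriv_qCoord, lineDeriv_hamiltonian b hx]
  simp [qCoord, pCoord, F, b.orthonormal, weight_apply_zero]

theorem poissonBracket_pCoord {x : PhaseSpace 𝔥} (hx : ∀ α ∈ 𝔥.root, α x.1 ∉ lattice τ)
    (μ : Fin ℓ) : poissonBracket b (pCoord b μ) (hamiltonian b τ) x
      = 1 / 2 * ∑ α ∈ 𝔥.root, deriv (wp τ) (α x.1) * α (b.h μ) * (F b (-α) x * F b α x) := by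
  simp only [poissonBracket, kostantKirillov, lineDeriv_pCoord, lineDeriv_hamiltonian b hx]
  simp [pCoord, F, b.orthonormal]

theorem poissonBracket_F {x : PhaseSpace 𝔥} (hx : ∀ α ∈ 𝔥.root, α x.1 ∉ lattice τ)
    (α : Weight ℂ 𝔥 𝔤) : poissonBracket b (F b α) (hamiltonian b τ) x
      = -∑ β ∈ 𝔥.root, wp τ (β x.1) * F b (-β) x * x.2.2 ⁅b.e α, b.e β⁆ := by
  have h0 : ∀ a c : 𝔥, F b α ((a, c, 0) : PhaseSpace 𝔥) = 0 := fun _ _ => by simp [F]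
  have h1 : ∀ ψ : Module.Dual ℂ 𝔤, F b α ((0, 0, ψ) : PhaseSpace 𝔥) = ψ (b.e α) := fun _ => rfl
  simp only [poissonBracket, kostantKirillov, lineDeriv_F, h0, h1, zero_mul, sub_zero,
    Finset.sum_const_zero, zero_add, lineDeriv_hamiltonian_dual b hx, mul_neg, neg_mul,
    Finset.sum_neg_distrib, sum_sum_coord_mul]
  simp only [lie_sum, lie_smul, map_sum, map_smul, smul_eq_mul]

end LieAlg

end SpinCalogeroMoser

end

noncomputable section

namespace SpinCalogeroMoser

open LieAlgebra LieModule

section LieAlg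

variable {𝔤 : Type*} [LieRing 𝔤] [LieAlgebra ℂ 𝔤] [FiniteDimensional ℂ 𝔤]
  [LieAlgebra.IsSimple ℂ 𝔤] {𝔥 : LieSubalgebra ℂ 𝔤} [𝔥.IsCartanSubalgebra]
  {ℓ : ℕ} (b : AdaptedBasis 𝔥 ℓ) {τ : UpperHalfPlane}

/-! ### The Lax equation in the Lie algebra -/

/-- The spin part of the commutator of the Lax matrices, for functions `s`, `r`, `w`, `f` on the
roots that satisfy the identities between `σ`, `ρ` and `℘`. -/
theorem lie_sum_e_sum_e (s r w w' f : Weight ℂ 𝔥 𝔤 → ℂ)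
    (hdiag : ∀ α ∈ 𝔥.root, s α * s (-α) * (r α - r (-α)) = w' α)
    (hoff : ∀ α ∈ 𝔥.root, ∀ β ∈ 𝔥.root, ∀ γ ∈ 𝔥.root, (∀ x, γ x = α x + β x) →
      s α * s β * (r α - r β) = s γ * (w β - w α)) :
    ⁅∑ α ∈ 𝔥.root, (s α * f (-α)) • b.e α, -∑ β ∈ 𝔥.root, (s β * r β * f (-β)) • b.e β⁆
      = (1 / 2 : ℂ) • ∑ α ∈ 𝔥.root, (w' α * (f (-α) * f α)) • b.hRoot α
        - ∑ γ ∈ 𝔥.root, (s γ * ∑ β ∈ 𝔥.root, ∑ α ∈ 𝔥.root,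
            w β * f (-β) * (f (-α) * b.structConst β α γ)) • b.e γ := by
  classical
  have hT : ⁅∑ α ∈ 𝔥.root, (s α * f (-α)) • b.e α, ∑ β ∈ 𝔥.root, (s β * r β * f (-β)) • b.e β⁆
      = ∑ α ∈ 𝔥.root, (s α * s (-α) * r (-α) * (f (-α) * f α)) • b.hRoot α
        + ∑ γ ∈ 𝔥.root, (∑ α ∈ 𝔥.root, ∑ β ∈ 𝔥.root,
            s α * s β * r β * (f (-α) * f (-β)) * b.structConst α β γ) • b.e γ := by
    rw [sum_lie_sum]
    have h1 : ∀ α ∈ 𝔥.root, ∀ β ∈ 𝔥.root,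
        ⁅(s α * f (-α)) • b.e α, (s β * r β * f (-β)) • b.e β⁆
          = (if β = -α then (s α * s (-α) * r (-α) * (f (-α) * f α)) • b.hRoot α else 0)
            + ∑ γ ∈ 𝔥.root,
              (s α * s β * r β * (f (-α) * f (-β)) * b.structConst α β γ) • b.e γ := by
      intro α hα β hβ
      rw [smul_lie, lie_smul, b.lie_e hα hβ, smul_smul, smul_add, Finset.smul_sum]
      congr 1
      · split_ifs with h
        · subst h
          rw [neg_neg]
          congr 1
          ring
        · rw [smul_zero]
      · refine Finset.sum_congr rfl fun γ _ => ?_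
        rw [smul_smul]
        congr 1
        ring
    rw [Finset.sum_congr rfl fun α hα => Finset.sum_congr rfl fun β hβ => h1 α hα β hβ]
    simp only [Finset.sum_add_distrib, Finset.sum_smul]
    congr 1
    · refine Finset.sum_congr rfl fun α hα => ?_
      rw [Finset.sum_ite_eq' _ _ _, if_pos (neg_mem_root hα)]
    · rw [Finset.sum_congr rfl fun α _ => Finset.sum_comm, Finset.sum_comm]
  -- Averaging over `α ↔ -α`, with `h_{-α} = -h_α`, produces the difference `r α - r (-α)` of
  -- `hdiag`.
  have hD : ∑ α ∈ 𝔥.root, (s α * s (-α) * r (-α) * (f (-α) * f α)) • b.hRoot α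
      = -((1 / 2 : ℂ) • ∑ α ∈ 𝔥.root, (w' α * (f (-α) * f α)) • b.hRoot α) := by
    have h1 := sum_root_neg (𝔥 := 𝔥) fun α =>
      (s α * s (-α) * r (-α) * (f (-α) * f α)) • b.hRoot α
    simp only [neg_neg, b.hRoot_neg] at h1
    have h2 : ∑ α ∈ 𝔥.root, (w' α * (f (-α) * f α)) • b.hRoot α
        = -∑ α ∈ 𝔥.root, (s (-α) * s α * r α * (f α * f (-α))) • -b.hRoot α
          - ∑ α ∈ 𝔥.root, (s α * s (-α) * r (-α) * (f (-α) * f α)) • b.hRoot α := by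
      rw [← Finset.sum_neg_distrib, ← Finset.sum_sub_distrib]
      refine Finset.sum_congr rfl fun α hα => ?_
      rw [← hdiag α hα]
      module
    rw [h2, h1]
    module
  -- The structure constants are antisymmetric in `α`, `β`, so only the antisymmetric parts of `r β`
  -- and `w β` count, and `hoff` compares these.
  have hO : ∀ γ ∈ 𝔥.root, ∑ α ∈ 𝔥.root, ∑ β ∈ 𝔥.root,
      s α * s β * r β * (f (-α) * f (-β)) * b.structConst α β γ
      = s γ * ∑ β ∈ 𝔥.root, ∑ α ∈ 𝔥.root,
            w β * f (-β) * (f (-α) * b.structConst β α γ) := by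
    intro γ hγ
    have h1 : ∑ α ∈ 𝔥.root, ∑ β ∈ 𝔥.root,
        s α * s β * r β * (f (-α) * f (-β)) * b.structConst α β γ
        = -∑ α ∈ 𝔥.root, ∑ β ∈ 𝔥.root,
          s α * s β * r α * (f (-α) * f (-β)) * b.structConst α β γ := by
      rw [Finset.sum_comm, ← Finset.sum_neg_distrib]
      refine Finset.sum_congr rfl fun β _ => ?_
      rw [← Finset.sum_neg_distrib]
      refine Finset.sum_congr rfl fun α _ => ?_
      rw [b.structConst_swap β α]
      ring
    have h2 : ∑ α ∈ 𝔥.root, ∑ β ∈ 𝔥.root,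
        w α * f (-α) * (f (-β) * b.structConst α β γ)
        = -∑ α ∈ 𝔥.root, ∑ β ∈ 𝔥.root,
          w β * f (-α) * (f (-β) * b.structConst α β γ) := by
      rw [Finset.sum_comm, ← Finset.sum_neg_distrib]
      refine Finset.sum_congr rfl fun β _ => ?_
      rw [← Finset.sum_neg_distrib]
      refine Finset.sum_congr rfl fun α _ => ?_
      rw [b.structConst_swap β α]
      ring
    have h3 : ∑ α ∈ 𝔥.root, ∑ β ∈ 𝔥.root,
        s α * s β * r β * (f (-α) * f (-β)) * b.structConst α β γ
        - ∑ α ∈ 𝔥.root, ∑ β ∈ 𝔥.root,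
          s α * s β * r α * (f (-α) * f (-β)) * b.structConst α β γ
        = s γ * ∑ α ∈ 𝔥.root, ∑ β ∈ 𝔥.root, w α * f (-α) * (f (-β) * b.structConst α β γ)
        - s γ * ∑ α ∈ 𝔥.root, ∑ β ∈ 𝔥.root,
          w β * f (-α) * (f (-β) * b.structConst α β γ) := by
      simp only [Finset.mul_sum, ← Finset.sum_sub_distrib]
      refine Finset.sum_congr rfl fun α hα => Finset.sum_congr rfl fun β hβ => ?_
      by_cases hc : b.structConst α β γ = 0
      · simp [hc]
      · have := hoff α hα β hβ γ hγ (b.coe_eq_add_of_structConst_ne_zero hα hβ hγ hc)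
        linear_combination -(f (-α) * f (-β) * b.structConst α β γ) * this
    linear_combination h3 / 2 + h1 / 2 - s γ * h2 / 2
  rw [lie_neg, hT, hD, neg_add, neg_neg, sub_eq_add_neg]
  congr 2
  exact Finset.sum_congr rfl fun γ hγ => by rw [hO γ hγ]

/-- Hamilton's equation for the spin variables, on the constraint surface `G = 0`. -/
theorem poissonBracket_F_neg {x : PhaseSpace 𝔥} (hx : ∀ α ∈ 𝔥.root, α x.1 ∉ lattice τ)
    (hG : ∀ μ, G b μ x = 0) (γ : Weight ℂ 𝔥 𝔤) :
    poissonBracket b (F b (-γ)) (hamiltonian b τ) x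
      = -∑ β ∈ 𝔥.root, ∑ α ∈ 𝔥.root,
          wp τ (β x.1) * F b (-β) x * (F b (-α) x * b.structConst β α γ) := by
  rw [poissonBracket_F b hx]
  congr 1
  refine Finset.sum_congr rfl fun β _ => ?_
  rw [← Finset.mul_sum]
  congr 1
  -- The constraint is used here: it kills `ξ` on the Cartan part of the bracket.
  have hG' : ∀ μ, x.2.2 (b.h μ : 𝔤) = 0 := hG
  conv_lhs => rw [← b.expansion ⁅b.e (-γ), b.e β⁆]
  simp only [map_add, map_sum, map_smul, hG', smul_zero, Finset.sum_const_zero, zero_add]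
  rw [← sum_root_neg]
  refine Finset.sum_congr rfl fun α _ => ?_
  rw [neg_neg, b.killingForm_lie_e_neg, smul_eq_mul, mul_comm]
  rfl

/-- The Lax matrix `L(z)`, as an element of `𝔤`. -/
def lieL (τ : UpperHalfPlane) (z : ℂ) (x : PhaseSpace 𝔥) : 𝔤 :=
  ∑ μ, pCoord b μ x • (b.h μ : 𝔤)
    + ∑ α ∈ 𝔥.root, (sigma τ (α x.1) z * F b (-α) x) • b.e α

/-- The Lax matrix `M(z)`, as an element of `𝔤`. -/
def lieM (τ : UpperHalfPlane) (z : ℂ) (x : PhaseSpace 𝔥) : 𝔤 :=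
  -∑ α ∈ 𝔥.root,
    (sigma τ (α x.1) z * (rho τ (α x.1) + rho τ (z - α x.1)) * F b (-α) x) • b.e α

/-- The right-hand side is what the chain rule gives for `dL/dt`, with `d(α·q)/dt = α(p)`. -/
theorem lie_lieL_lieM {x : PhaseSpace 𝔥} {z : ℂ} (hx : ∀ α ∈ 𝔥.root, α x.1 ∉ lattice τ)
    (hG : ∀ μ, G b μ x = 0) (hz : z ∉ lattice τ)
    (hzx : ∀ α ∈ 𝔥.root, z - α x.1 ∉ lattice τ) :
    ⁅lieL b τ z x, lieM b τ z x⁆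
      = ∑ μ, poissonBracket b (pCoord b μ) (hamiltonian b τ) x • (b.h μ : 𝔤)
        + ∑ α ∈ 𝔥.root,
          (-(sigma τ (α x.1) z * (rho τ (α x.1) + rho τ (z - α x.1))) * α x.2.1 * F b (-α) x
            + sigma τ (α x.1) z * poissonBracket b (F b (-α)) (hamiltonian b τ) x) • b.e α := by
  have hP : ∑ μ, pCoord b μ x • (b.h μ : 𝔤) = x.2.1 := by
    conv_rhs => rw [← b.sum_killingForm_smul x.2.1]
    simp [pCoord]
  have hspin := lie_sum_e_sum_e b (fun α => sigma τ (α x.1) z)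
    (fun α => rho τ (α x.1) + rho τ (z - α x.1)) (fun α => wp τ (α x.1))
    (fun α => deriv (wp τ) (α x.1)) (fun α => F b α x)
    (fun α hα => by
      have h := hzx (-α) (neg_mem_root hα)
      rw [Weight.coe_neg, Pi.neg_apply, sub_neg_eq_add] at h ⊢
      exact sigma_mul_sigma_neg_mul_rho (hx α hα) hz (hzx α hα) h)
    (fun α hα β hβ γ hγ h => by
      have hγ' := hx γ hγ
      rw [h] at hγ' ⊢
      exact sigma_mul_sigma_mul_rho (hx α hα) (hx β hβ) hγ' hz (hzx α hα) (hzx β hβ))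
  have hcart : ∀ y : 𝔤, ∀ c : Weight ℂ 𝔥 𝔤 → ℂ, y = x.2.1 →
      ⁅y, -∑ α ∈ 𝔥.root, c α • b.e α⁆ = ∑ α ∈ 𝔥.root, (-(c α * α x.2.1)) • b.e α := by
    rintro _ c rfl
    rw [lie_neg, lie_sum, ← Finset.sum_neg_distrib]
    refine Finset.sum_congr rfl fun α hα => ?_
    rw [lie_smul, b.lie_h_e _ hα, smul_smul, neg_smul]
  have hp : ∑ μ, poissonBracket b (pCoord b μ) (hamiltonian b τ) x • (b.h μ : 𝔤)
      = (1 / 2 : ℂ) • ∑ α ∈ 𝔥.root,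
        (deriv (wp τ) (α x.1) * (F b (-α) x * F b α x)) • b.hRoot α := by
    simp only [poissonBracket_pCoord b hx, AdaptedBasis.hRoot, Finset.smul_sum, Finset.mul_sum,
      Finset.sum_smul, smul_smul]
    rw [Finset.sum_comm]
    refine Finset.sum_congr rfl fun α _ => Finset.sum_congr rfl fun μ _ => ?_
    congr 1
    ring
  rw [lieL, lieM, add_lie, hspin, hcart _ _ hP, hp]
  simp only [poissonBracket_F_neg b hx hG, add_smul, Finset.sum_add_distrib, mul_neg, neg_smul,
    Finset.sum_neg_distrib, neg_mul]
  rw [sub_eq_add_neg, add_left_comm]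
  congr 3
  refine Finset.sum_congr rfl fun α _ => ?_
  congr 1
  ring

end LieAlg

end SpinCalogeroMoser

end

/-! ### The Lax equation in a representation -/

theorem mainTheorem7
    {𝔤 : Type*} [LieRing 𝔤] [LieAlgebra ℂ 𝔤] [FiniteDimensional ℂ 𝔤] [LieAlgebra.IsSimple ℂ 𝔤]
    (𝔥 : LieSubalgebra ℂ 𝔤) [𝔥.IsCartanSubalgebra]
    {ℓ : ℕ} (b : SpinCalogeroMoser.AdaptedBasis 𝔥 ℓ)
    (V : Type*) [AddCommGroup V] [Module ℂ V] [FiniteDimensional ℂ V]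
    [LieRingModule 𝔤 V] [LieModule ℂ 𝔤 V]
    (τ : UpperHalfPlane)
    {𝕜 : Type*} [RCLike 𝕜] [NormedAlgebra 𝕜 ℂ]
    (γ : 𝕜 → SpinCalogeroMoser.PhaseSpace 𝔥) (I : Set 𝕜)
    (hγ : SpinCalogeroMoser.IsTrajectoryOn b τ γ I)
    (hG : ∀ t ∈ I, ∀ μ, SpinCalogeroMoser.G b μ (γ t) = 0)
    (t : 𝕜) (ht : t ∈ I) (z : ℂ) (hz : z ∉ SpinCalogeroMoser.lattice τ)
    (hzq : ∀ α ∈ 𝔥.root, z - α (γ t).1 ∉ SpinCalogeroMoser.lattice τ) :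
    SpinCalogeroMoser.EndHasDerivAt
      (fun s => SpinCalogeroMoser.laxL b V τ z (γ s))
      (SpinCalogeroMoser.laxL b V τ z (γ t) * SpinCalogeroMoser.laxM b V τ z (γ t)
        - SpinCalogeroMoser.laxM b V τ z (γ t) * SpinCalogeroMoser.laxL b V τ z (γ t))
      t := by
  open SpinCalogeroMoser LieModule in
  intro φ v
  have hx := hγ.regular t ht
  have hL : ∀ s, laxL b V τ z (γ s) = toEnd ℂ 𝔤 V (lieL b τ z (γ s)) := fun s => by
    simp only [laxL, lieL, map_add, map_sum, map_smul]
  have hM : laxM b V τ z (γ t) = toEnd ℂ 𝔤 V (lieM b τ z (γ t)) := by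
    simp only [laxM, lieM, map_neg, map_sum, map_smul]
  -- As `dq_μ/dt = p_μ`, expanding `α` in the orthonormal basis gives `d(α·q)/dt = α(p)`.
  have hα : ∀ α : Weight ℂ 𝔥 𝔤, HasDerivAt (fun s => α (γ s).1) (α (γ t).2.1) t := fun α => by
    have h := HasDerivAt.fun_sum (u := Finset.univ) fun μ _ =>
      (hγ.deriv_q t ht μ).const_mul (α (b.h μ))
    simp only [poissonBracket_qCoord b hx] at h
    simpa only [qCoord, pCoord, b.sum_killingForm_mul_apply] using h
  have hlie : ∀ x y : 𝔤, toEnd ℂ 𝔤 V x * toEnd ℂ 𝔤 V y - toEnd ℂ 𝔤 V y * toEnd ℂ 𝔤 V x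
      = toEnd ℂ 𝔤 V ⁅x, y⁆ := fun x y => by
    ext v
    simp
  rw [hM, hL, hlie, lie_lieL_lieM b hx (hG t ht) hz hzq]
  simp only [laxL, map_add, map_sum, map_smul, LinearMap.add_apply, LinearMap.sum_apply,
    LinearMap.smul_apply, smul_eq_mul]
  refine (HasDerivAt.fun_sum fun μ _ => (hγ.deriv_p t ht μ).mul_const _).add
    (HasDerivAt.fun_sum fun α hα' => ?_)
  exact (((hasDerivAt_sigma (hx α hα') hz (hzq α hα')).comp t (hα α)).mul
    (hγ.deriv_F t ht (-α) (neg_mem_root hα'))).mul_const _
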